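/- Let $n\ge 1$, let $r_0>0$, and let $B_{r_0}=\{x\in\mathbb R^n:|x|<r_0\}$. Let $u$ be a real-valued function which is harmonic on $\mathbb R^n\setminus B_{r_0}$, in the sense that $u$ is continuous on $\{|x|\ge r_0\}$, and is $C^2$ with $\Delta u=0$ on the open set $\{|x|>r_0\}$. (In particular this covers functions harmonic in a neighbourhood of $\mathbb R^n\setminus B_{r_0}$.) (1) If $u$ vanishes to infinite order in the $L^2$ sense at infinity, that is, $$\lim_{r\to\infty} r^m\int_{|x|>r}|u|^2\,dx=0\quad\text{for every real } m\ge 0,$$ then $u\equiv 0$ on $\mathbb R^n\setminus B_{r_0}$. (2) Namely, if $u\neq 0$ somewhere on $\mathbb R^n\setminus B_{r_0}$, then there is a real $N\ge 0$ such that $$\limsup_{r\to\infty} r^N\int_{|x|>r}|u|^2\,dx=\infty.$$ Here the integrals are taken in $[0,\infty]$. -/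

import Mathlib

open Filter Topology MeasureTheory Metric InnerProductSpace
open scoped ENNReal

/-- The tail integral `∫_{|x| > r} |u|²` over `ℝⁿ` with Lebesgue measure, as an extended
nonnegative number (it is `∞` when `u` is not square integrable on `{|x| > r}`). -/
noncomputable def tailL2 {n : ℕ} (u : EuclideanSpace ℝ (Fin n) → ℝ) (r : ℝ) : ℝ≥0∞ :=
  ∫⁻ x in {x : EuclideanSpace ℝ (Fin n) | r < ‖x‖}, ENNReal.ofReal (|u x| ^ 2)

/-- `u` vanishes to infinite order in the `L²` sense at infinity: for every real `m ≥ 0`,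
`r ^ m * ∫_{|x| > r} |u|² → 0` as `r → ∞`. -/
def VanishesToInfiniteOrderAtInfinity {n : ℕ} (u : EuclideanSpace ℝ (Fin n) → ℝ) : Prop :=
  ∀ m : ℝ, 0 ≤ m →
    Tendsto (fun r : ℝ => ENNReal.ofReal (r ^ m) * tailL2 u r) atTop (𝓝 0)

/-!
Rapid decay makes all polynomial moments of `u` finite away from the ball, so Green's identity,
after cutting off at infinity, gives `∫ u Δψ = 0` for every `ψ` of polynomial growth that vanishes
for `|x|² < b`, where `b > r₀²`. Take `ψ = p(x) g(|x|²)` with `p` homogeneous of degree `k`. By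
induction on `k` the contribution of `Δp`, which has degree `k - 2`, vanishes, and with `h = g'` and
`s = |x|²` there remains the Euler-type identity `∫ u p (s h'(s) + (k + n/2) h(s)) = 0`. Replacing
`h` by `h(t ·)`, this is the differential equation `t Φ' = -(k + n/2) Φ` for
`Φ(t) = ∫ u p h(t |x|²)`. Since `Φ(0) = 0`, the function `Φ²` is nonincreasing on `[0, 1]`, whence
`Φ(1) = 0`. Therefore `u h(|x|²)` is orthogonal to all polynomials, and by Stone–Weierstrass it
vanishes for every bump function `h` supported in `(b, ∞)`.
-/

section LaplacianCalculus

open scoped Gradient Laplacian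

variable {E : Type*} [NormedAddCommGroup E] [InnerProductSpace ℝ E] [FiniteDimensional ℝ E]
  {ι : Type*} [Fintype ι]

lemma laplacian_eq_sum_fderiv_fderiv (e : OrthonormalBasis ι ℝ E) {f : E → ℝ} {x : E}
    (hf : ContDiffAt ℝ 2 f x) :
    Δ f x = ∑ i, fderiv ℝ (fun y => fderiv ℝ f y (e i)) x (e i) := by
  have hf' : DifferentiableAt ℝ (fderiv ℝ f) x :=
    (hf.fderiv_right (m := 1) le_rfl).differentiableAt one_ne_zero
  rw [laplacian_eq_iteratedFDeriv_orthonormalBasis f e]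
  refine Finset.sum_congr rfl fun i _ => ?_
  rw [iteratedFDeriv_two_apply, fderiv_clm_apply hf' (differentiableAt_const _)]
  simp

lemma abs_laplacian_le (f : E → ℝ) (x : E) :
    |Δ f x| ≤ Module.finrank ℝ E * ‖iteratedFDeriv ℝ 2 f x‖ := by
  rw [laplacian_eq_iteratedFDeriv_stdOrthonormalBasis f]
  calc _ ≤ ∑ i, ‖iteratedFDeriv ℝ 2 f x
          ![stdOrthonormalBasis ℝ E i, stdOrthonormalBasis ℝ E i]‖ := norm_sum_le _ _
    _ ≤ ∑ _ : Fin (Module.finrank ℝ E), ‖iteratedFDeriv ℝ 2 f x‖ :=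
        Finset.sum_le_sum fun i _ =>
          ((iteratedFDeriv ℝ 2 f x).le_opNorm _).trans_eq (by simp [Fin.prod_univ_two])
    _ = _ := by simp

lemma laplacian_mul {f g : E → ℝ} {x : E} (hf : ContDiffAt ℝ 2 f x) (hg : ContDiffAt ℝ 2 g x) :
    Δ (fun y => f y * g y) x = f x * Δ g x + 2 * inner ℝ (∇ f x) (∇ g x) + g x * Δ f x := by
  let e := stdOrthonormalBasis ℝ E
  have hderiv {φ : E → ℝ} (hφ : ContDiffAt ℝ 2 φ x) (v : E) :
      DifferentiableAt ℝ (fun y => fderiv ℝ φ y v) x :=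
    ((hφ.fderiv_right (m := 1) le_rfl).differentiableAt one_ne_zero).clm_apply
      (differentiableAt_const v)
  have hd {φ : E → ℝ} (hφ : ContDiffAt ℝ 2 φ x) : DifferentiableAt ℝ φ x :=
    hφ.differentiableAt two_ne_zero
  have hfirst (v : E) : (fun y => fderiv ℝ (fun z => f z * g z) y v) =ᶠ[𝓝 x]
      fun y => f y * fderiv ℝ g y v + g y * fderiv ℝ f y v := by
    filter_upwards [hf.eventually (by simp), hg.eventually (by simp)] with y hfy hgy
    rw [fderiv_fun_mul (hfy.differentiableAt two_ne_zero) (hgy.differentiableAt two_ne_zero)]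
    rfl
  rw [laplacian_eq_sum_fderiv_fderiv e (hf.mul hg), laplacian_eq_sum_fderiv_fderiv e hf,
    laplacian_eq_sum_fderiv_fderiv e hg, ← e.sum_inner_mul_inner, Finset.mul_sum, Finset.mul_sum,
    Finset.mul_sum, ← Finset.sum_add_distrib, ← Finset.sum_add_distrib]
  refine Finset.sum_congr rfl fun i _ => ?_
  rw [(hfirst _).fderiv_eq, fderiv_fun_add ((hd hf).fun_mul (hderiv hg _))
      ((hd hg).fun_mul (hderiv hf _)),
    fderiv_fun_mul (hd hf) (hderiv hg _), fderiv_fun_mul (hd hg) (hderiv hf _),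
    inner_gradient_left, inner_gradient_right]
  simp only [add_apply, smul_apply, smul_eq_mul, conj_trivial]
  ring

lemma hasGradientAt_comp_norm_sq {g : ℝ → ℝ} {g' : ℝ} {x : E} (hg : HasDerivAt g g' (‖x‖ ^ 2)) :
    HasGradientAt (fun y => g (‖y‖ ^ 2)) ((2 * g') • x) x := by
  rw [hasGradientAt_iff_hasFDerivAt]
  convert! hg.comp_hasFDerivAt x (hasStrictFDerivAt_norm_sq x).hasFDerivAt using 1
  ext v
  simp only [map_smul, smul_apply, toDual_apply_apply, smul_eq_mul, coe_innerSL_apply,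
    nsmul_eq_mul, Nat.cast_ofNat]
  ring

lemma laplacian_comp_norm_sq {g : ℝ → ℝ} (hg : ContDiff ℝ 2 g) (x : E) :
    Δ (fun y : E => g (‖y‖ ^ 2)) x = 4 * ‖x‖ ^ 2 * deriv (deriv g) (‖x‖ ^ 2) +
      2 * Module.finrank ℝ E * deriv g (‖x‖ ^ 2) := by
  let e := stdOrthonormalBasis ℝ E
  have hfirst (v y : E) :
      fderiv ℝ (fun z => g (‖z‖ ^ 2)) y v = 2 * deriv g (‖y‖ ^ 2) * inner ℝ y v := by
    have hgy := (hg.differentiable two_ne_zero (‖y‖ ^ 2)).hasDerivAt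
    rw [(hasGradientAt_comp_norm_sq hgy).fderiv_apply, real_inner_smul_left]
  have hsecond (v : E) : fderiv ℝ (fun y => 2 * deriv g (‖y‖ ^ 2) * inner ℝ y v) x v =
      4 * deriv (deriv g) (‖x‖ ^ 2) * inner ℝ x v ^ 2 + 2 * deriv g (‖x‖ ^ 2) * ‖v‖ ^ 2 := by
    have hgx := (hg.differentiable_deriv_two (‖x‖ ^ 2)).hasDerivAt
    have hinner : HasFDerivAt (fun y => inner ℝ y v) ((innerSL ℝ).flip v) x :=
      ((innerSL ℝ).flip v).hasFDerivAt
    rw [HasFDerivAt.fderiv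
      (((hasGradientAt_comp_norm_sq hgx).hasFDerivAt.const_mul 2).fun_mul hinner)]
    simp only [flip_innerSL_real, map_smul, add_apply, smul_apply, innerSL_apply_apply ℝ,
      inner_self_eq_norm_sq_to_K, Real.ringHom_apply, smul_eq_mul, toDual_apply_apply]
    ring
  rw [laplacian_eq_sum_fderiv_fderiv e (hg.fun_comp (contDiff_norm_sq ℝ)).contDiffAt]
  simp only [hfirst, hsecond, Finset.sum_add_distrib, ← Finset.mul_sum,
    OrthonormalBasis.norm_eq_one, e.sum_sq_inner_left]
  simp only [one_pow, Finset.sum_const, Finset.card_univ, Fintype.card_fin, nsmul_eq_mul,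
    mul_one]
  ring

end LaplacianCalculus

section EvalPolynomial

open MvPolynomial
open scoped Gradient Laplacian

variable {ι : Type*} [Fintype ι] (p : MvPolynomial ι ℝ)

lemma hasFDerivAt_eval (x : EuclideanSpace ℝ ι) :
    HasFDerivAt (fun y : EuclideanSpace ℝ ι => eval y.ofLp p)
      (∑ i, eval x.ofLp (pderiv i p) • EuclideanSpace.proj (𝕜 := ℝ) i) x := by
  classical
  induction p using MvPolynomial.induction_on with
  | C c => simpa using hasFDerivAt_const c x
  | add p q hp hq => simpa [add_smul, Finset.sum_add_distrib] using hp.fun_add hq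
  | mul_X p j hp =>
    convert! hp.mul (EuclideanSpace.proj (𝕜 := ℝ) j).hasFDerivAt using 1
    · ext; simp
    · ext v
      simp [pderiv_X, Pi.single_apply, apply_ite, Finset.sum_add_distrib, add_mul, Finset.mul_sum,
        mul_assoc]

lemma hasTemperateGrowth_eval :
    (fun x : EuclideanSpace ℝ ι => eval x.ofLp p).HasTemperateGrowth := by
  induction p using MvPolynomial.induction_on with
  | C c => simp
  | add p q hp hq => simpa using! hp.add hq
  | mul_X p j hp => simpa using! hp.mul (EuclideanSpace.proj (𝕜 := ℝ) j).hasTemperateGrowth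

lemma laplacian_eval (x : EuclideanSpace ℝ ι) :
    Δ (fun y : EuclideanSpace ℝ ι => eval y.ofLp p) x =
      eval x.ofLp (∑ i, pderiv i (pderiv i p)) := by
  classical
  have hfirst (q : MvPolynomial ι ℝ) (i : ι) (y : EuclideanSpace ℝ ι) :
      fderiv ℝ (fun z : EuclideanSpace ℝ ι => eval z.ofLp q) y
        (EuclideanSpace.basisFun ι ℝ i) = eval y.ofLp (pderiv i q) := by
    rw [(hasFDerivAt_eval q y).fderiv]
    simp [EuclideanSpace.basisFun_apply, PiLp.single_apply]
  rw [laplacian_eq_sum_fderiv_fderiv (EuclideanSpace.basisFun ι ℝ)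
    ((hasTemperateGrowth_eval p).1.of_le ENat.LEInfty.out).contDiffAt]
  simp only [hfirst, map_sum]

variable {p}

lemma inner_gradient_eval_self {k : ℕ} (hp : p.IsHomogeneous k) (x : EuclideanSpace ℝ ι) :
    inner ℝ (∇ (fun y : EuclideanSpace ℝ ι => eval y.ofLp p) x) x = k * eval x.ofLp p := by
  rw [inner_gradient_left, (hasFDerivAt_eval p x).fderiv]
  simpa [mul_comm] using congrArg (eval x.ofLp) hp.sum_X_mul_pderiv

lemma laplacian_eval_mul_comp_norm_sq {k : ℕ} (hp : p.IsHomogeneous k) {g : ℝ → ℝ}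
    (hg : ContDiff ℝ 2 g) (x : EuclideanSpace ℝ ι) :
    Δ (fun y : EuclideanSpace ℝ ι => eval y.ofLp p * g (‖y‖ ^ 2)) x =
      eval x.ofLp p * (4 * ‖x‖ ^ 2 * deriv (deriv g) (‖x‖ ^ 2) +
        (4 * k + 2 * Fintype.card ι) * deriv g (‖x‖ ^ 2)) +
      eval x.ofLp (∑ i, pderiv i (pderiv i p)) * g (‖x‖ ^ 2) := by
  have hgx := (hg.differentiable two_ne_zero (‖x‖ ^ 2)).hasDerivAt
  rw [laplacian_mul ((hasTemperateGrowth_eval p).1.of_le ENat.LEInfty.out).contDiffAt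
    (hg.fun_comp (contDiff_norm_sq ℝ)).contDiffAt, laplacian_comp_norm_sq hg, laplacian_eval,
    (hasGradientAt_comp_norm_sq hgx).gradient, real_inner_smul_right, inner_gradient_eval_self hp,
    finrank_euclideanSpace]
  ring

end EvalPolynomial

section GreenIdentity

open scoped Laplacian

lemma integrable_mul_of_tsupport_subset {X : Type*} [TopologicalSpace X] [MeasurableSpace X]
    [OpensMeasurableSpace X] {μ : Measure X} [IsFiniteMeasureOnCompacts μ]
    {U : Set X} {f g : X → ℝ} (hU : IsOpen U) (hf : ContinuousOn f U) (hg : Continuous g)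
    (hgc : HasCompactSupport g) (hgU : tsupport g ⊆ U) :
    Integrable (fun x => f x * g x) μ := by
  have hcont : Continuous fun x => f x * g x :=
    (hf.mul hg.continuousOn).continuous_of_tsupport_subset hU
      ((tsupport_mul_subset_right).trans hgU)
  exact hcont.integrable_of_hasCompactSupport hgc.mul_left

variable {E : Type*} [NormedAddCommGroup E] [InnerProductSpace ℝ E] [FiniteDimensional ℝ E]
  [MeasurableSpace E] [BorelSpace E] {μ : Measure E} [μ.IsAddHaarMeasure] {U : Set E} {f g : E → ℝ}

lemma integral_mul_fderiv_eq_neg_of_tsupport_subset (hU : IsOpen U) (hf : ContDiffOn ℝ 1 f U)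
    (hg : ContDiff ℝ 1 g) (hgc : HasCompactSupport g) (hgU : tsupport g ⊆ U) (v : E) :
    ∫ x, f x * fderiv ℝ g x v ∂μ = -∫ x, fderiv ℝ f x v * g x ∂μ := by
  have hf' : ContinuousOn (fun x => fderiv ℝ f x v) U :=
    (hf.continuousOn_fderiv_of_isOpen hU le_rfl).clm_apply continuousOn_const
  have hg' : Continuous fun x => fderiv ℝ g x v :=
    (hg.continuous_fderiv one_ne_zero).clm_apply continuous_const
  refine integral_mul_fderiv_eq_neg_fderiv_mul_of_integrable
    (integrable_mul_of_tsupport_subset hU hf' hg.continuous hgc hgU)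
    (integrable_mul_of_tsupport_subset hU hf.continuousOn hg' (hgc.fderiv_apply ℝ v)
      ((tsupport_fderiv_apply_subset ℝ v).trans hgU))
    (integrable_mul_of_tsupport_subset hU hf.continuousOn hg.continuous hgc hgU)
    (fun x hx => ?_) fun x _ => hg.differentiable one_ne_zero x
  exact (hf.contDiffAt (hU.mem_nhds (hgU hx))).differentiableAt one_ne_zero

lemma integral_mul_laplacian_comm_of_tsupport_subset (hU : IsOpen U) (hf : ContDiffOn ℝ 2 f U)
    (hg : ContDiff ℝ 2 g) (hgc : HasCompactSupport g) (hgU : tsupport g ⊆ U) :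
    ∫ x, f x * Δ g x ∂μ = ∫ x, Δ f x * g x ∂μ := by
  let e := stdOrthonormalBasis ℝ E
  have hf' (v : E) : ContDiffOn ℝ 1 (fun x => fderiv ℝ f x v) U :=
    (hf.fderiv_of_isOpen hU le_rfl).clm_apply contDiffOn_const
  have hg' (v : E) : ContDiff ℝ 1 fun x => fderiv ℝ g x v :=
    (hg.fderiv_right le_rfl).clm_apply contDiff_const
  have hgU' (v : E) : tsupport (fun x => fderiv ℝ g x v) ⊆ U :=
    (tsupport_fderiv_apply_subset ℝ v).trans hgU
  have hfsum (x : E) : Δ f x * g x =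
      ∑ i, fderiv ℝ (fun y => fderiv ℝ f y (e i)) x (e i) * g x := by
    by_cases hx : x ∈ tsupport g
    · rw [laplacian_eq_sum_fderiv_fderiv e (hf.contDiffAt (hU.mem_nhds (hgU hx))), Finset.sum_mul]
    · simp [image_eq_zero_of_notMem_tsupport hx]
  have hfirst (v : E) :
      ∫ x, f x * fderiv ℝ (fun y => fderiv ℝ g y v) x v ∂μ =
        ∫ x, fderiv ℝ (fun y => fderiv ℝ f y v) x v * g x ∂μ := by
    rw [integral_mul_fderiv_eq_neg_of_tsupport_subset hU (hf.of_le one_le_two) (hg' v)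
      (hgc.fderiv_apply ℝ v) (hgU' v), integral_mul_fderiv_eq_neg_of_tsupport_subset hU (hf' v)
      (hg.of_le one_le_two) hgc hgU, neg_neg]
  simp only [hfsum, laplacian_eq_sum_fderiv_fderiv e hg.contDiffAt, Finset.mul_sum]
  rw [integral_finsetSum _ fun i _ => ?_, integral_finsetSum _ fun i _ => ?_]
  · exact Finset.sum_congr rfl fun i _ => hfirst _
  · exact integrable_mul_of_tsupport_subset hU
      (((hf' _).continuousOn_fderiv_of_isOpen hU le_rfl).clm_apply continuousOn_const)
      hg.continuous hgc hgU
  · exact integrable_mul_of_tsupport_subset hU hf.continuousOn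
      (((hg' _).continuous_fderiv one_ne_zero).clm_apply continuous_const)
      ((hgc.fderiv_apply ℝ _).fderiv_apply ℝ _)
      ((tsupport_fderiv_apply_subset ℝ _).trans (hgU' _))

lemma integral_mul_laplacian_eq_zero_of_harmonicOnNhd (hU : IsOpen U) (hf : HarmonicOnNhd f U)
    (hg : ContDiff ℝ 2 g) (hgc : HasCompactSupport g) (hgU : tsupport g ⊆ U) :
    ∫ x, f x * Δ g x ∂μ = 0 := by
  rw [integral_mul_laplacian_comm_of_tsupport_subset hU hf.contDiffOn hg hgc hgU]
  refine integral_eq_zero_of_ae (.of_forall fun x => ?_)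
  by_cases hx : x ∈ tsupport g
  · simp [(hf x (hgU hx)).2.self_of_nhds]
  · simp [image_eq_zero_of_notMem_tsupport hx]

end GreenIdentity

section Moments

/-- The polynomial moments of `v` are all finite, so that `v` can be integrated against every
function of at most polynomial growth. -/
def HasFiniteMoments {E : Type*} [NormedAddCommGroup E] [MeasureSpace E] (v : E → ℝ) : Prop :=
  ∀ m : ℕ, Integrable fun x => (1 + ‖x‖) ^ m * v x

lemma norm_mul_le_of_norm_le {E : Type*} [SeminormedAddGroup E] {v φ : E → ℝ} {C : ℝ} {m : ℕ}
    {x : E} (hφ : ‖φ x‖ ≤ C * (1 + ‖x‖) ^ m) :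
    ‖v x * φ x‖ ≤ C * ‖(1 + ‖x‖) ^ m * v x‖ := by
  calc ‖v x * φ x‖ = ‖φ x‖ * ‖v x‖ := by rw [norm_mul, mul_comm]
    _ ≤ C * (1 + ‖x‖) ^ m * ‖v x‖ := by gcongr
    _ = C * ‖(1 + ‖x‖) ^ m * v x‖ := by
        rw [norm_mul, norm_pow, Real.norm_of_nonneg (by positivity : 0 ≤ 1 + ‖x‖), mul_assoc]

namespace HasFiniteMoments

variable {E : Type*} [NormedAddCommGroup E] [MeasureSpace E] {v φ : E → ℝ}

lemma aestronglyMeasurable (hv : HasFiniteMoments v) : AEStronglyMeasurable v := by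
  simpa using (hv 0).aestronglyMeasurable

lemma integrable_mul (hv : HasFiniteMoments v) (hφ : AEStronglyMeasurable φ) {C : ℝ} {m : ℕ}
    (hφm : ∀ x, ‖φ x‖ ≤ C * (1 + ‖x‖) ^ m) : Integrable fun x => v x * φ x :=
  ((hv m).norm.const_mul C).mono' (hv.aestronglyMeasurable.mul hφ)
    (.of_forall fun x => norm_mul_le_of_norm_le (hφm x))

lemma mul_temperate [NormedSpace ℝ E] [OpensMeasurableSpace E] (hv : HasFiniteMoments v)
    (hφ : φ.HasTemperateGrowth) : HasFiniteMoments fun x => v x * φ x := by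
  intro m
  obtain ⟨k, C, hC⟩ := hφ.2 0
  have hmeas : AEStronglyMeasurable fun x => (1 + ‖x‖) ^ m * φ x :=
    (((continuous_const.add continuous_norm).pow m).mul hφ.1.continuous).aestronglyMeasurable
  refine (hv.integrable_mul hmeas (C := C) (m := m + k) fun x => ?_).congr
    (.of_forall fun x => by ring)
  have hx : ‖φ x‖ ≤ C * (1 + ‖x‖) ^ k := by simpa using hC x
  calc ‖(1 + ‖x‖) ^ m * φ x‖ = (1 + ‖x‖) ^ m * ‖φ x‖ := by
        rw [norm_mul, Real.norm_of_nonneg (by positivity)]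
    _ ≤ (1 + ‖x‖) ^ m * (C * (1 + ‖x‖) ^ k) := by gcongr
    _ = C * (1 + ‖x‖) ^ (m + k) := by ring

lemma integrable_mul_temperate [NormedSpace ℝ E] [OpensMeasurableSpace E]
    (hv : HasFiniteMoments v) (hφ : φ.HasTemperateGrowth) :
    Integrable fun x => v x * φ x := by
  simpa using hv.mul_temperate hφ 0

end HasFiniteMoments

variable {n : ℕ} {u : EuclideanSpace ℝ (Fin n) → ℝ}

lemma setLIntegral_shell_le {k : ℕ} (hk : 1 ≤ k) (M : ℕ) :
    ∫⁻ x in {x | (k : ℝ) < ‖x‖ ∧ ‖x‖ ≤ k + 1}, ENNReal.ofReal ((1 + ‖x‖) ^ M * |u x| ^ 2) ≤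
      ENNReal.ofReal ((3 * k) ^ M) * tailL2 u k := by
  rw [tailL2, ← lintegral_const_mul' _ _ ENNReal.ofReal_ne_top]
  refine (setLIntegral_mono' (measurableSet_lt measurable_const measurable_norm |>.inter
    (measurableSet_le measurable_norm measurable_const)) fun x hx => ?_).trans
    (lintegral_mono_set fun x hx => hx.1)
  rw [← ENNReal.ofReal_mul (by positivity)]
  have hk' : (1 : ℝ) ≤ k := mod_cast hk
  have hle : 1 + ‖x‖ ≤ 3 * k := by linarith [show ‖x‖ ≤ k + 1 from hx.2]
  gcongr

lemma VanishesToInfiniteOrderAtInfinity.exists_setLIntegral_lt_top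
    (hV : VanishesToInfiniteOrderAtInfinity u) (M : ℕ) :
    ∃ N : ℕ, ∫⁻ x in {x | (N : ℝ) < ‖x‖}, ENNReal.ofReal ((1 + ‖x‖) ^ M * |u x| ^ 2) < ∞ := by
  have htail : ∀ᶠ k : ℕ in atTop, ENNReal.ofReal ((k : ℝ) ^ (M + 2)) * tailL2 u k ≤ 1 := by
    have := (hV (M + 2 : ℕ) (by positivity)).comp tendsto_natCast_atTop_atTop
    simp only [Real.rpow_natCast, Function.comp_def] at this
    exact this.eventually_le_const one_pos
  obtain ⟨N, hN⟩ := eventually_atTop.1 (htail.and (eventually_ge_atTop 1))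
  refine ⟨N, ?_⟩
  have hshell (j : ℕ) : ENNReal.ofReal ((3 * (N + j : ℕ)) ^ M) * tailL2 u (N + j : ℕ) ≤
      ENNReal.ofReal (3 ^ M * (1 / ((N + j : ℕ) : ℝ) ^ 2)) := by
    obtain ⟨hle, hpos⟩ := hN (N + j) (Nat.le_add_right _ _)
    have : (0 : ℝ) < (N + j : ℕ) := mod_cast hpos
    calc _ = ENNReal.ofReal (3 ^ M * (1 / ((N + j : ℕ) : ℝ) ^ 2)) *
          (ENNReal.ofReal (((N + j : ℕ) : ℝ) ^ (M + 2)) * tailL2 u (N + j : ℕ)) := by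
          rw [← mul_assoc, ← ENNReal.ofReal_mul (by positivity)]
          congr 2
          field_simp
          ring
      _ ≤ _ := mul_le_of_le_one_right' hle
  have hcover : {x : EuclideanSpace ℝ (Fin n) | (N : ℝ) < ‖x‖} ⊆
      ⋃ j : ℕ, {x | ((N + j : ℕ) : ℝ) < ‖x‖ ∧ ‖x‖ ≤ (N + j : ℕ) + 1} := by
    intro x (hx : (N : ℝ) < ‖x‖)
    obtain ⟨k, hk⟩ := Nat.exists_eq_add_of_lt (Nat.lt_ceil.2 hx)
    obtain ⟨hlt, hle⟩ := (Nat.ceil_eq_iff (by lia)).1 hk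
    exact Set.mem_iUnion.2 ⟨k, by simpa using hlt, mod_cast hle⟩
  have hsum : Summable fun j : ℕ => 3 ^ M * (1 / ((N + j : ℕ) : ℝ) ^ 2) := by
    simp_rw [add_comm N]
    exact ((summable_nat_add_iff N).2 (Real.summable_one_div_nat_pow.2 one_lt_two)).mul_left _
  calc _ ≤ _ := lintegral_mono_set hcover
    _ ≤ _ := lintegral_iUnion_le _ _
    _ ≤ _ := ENNReal.tsum_le_tsum fun j =>
      (setLIntegral_shell_le (hN (N + j) (Nat.le_add_right _ _)).2 M).trans (hshell j)
    _ < ∞ := hsum.tsum_ofReal_lt_top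

lemma setOf_le_norm_sq_subset {E : Type*} [SeminormedAddGroup E] {r₀ b : ℝ} (hb : r₀ ^ 2 < b) :
    {x : E | b ≤ ‖x‖ ^ 2} ⊆ {x | r₀ < ‖x‖} :=
  fun x hx => lt_of_pow_lt_pow_left₀ 2 (norm_nonneg x) (hb.trans_le hx)

lemma memLp_two_indicator_of_tail {r₀ b : ℝ} (hu : ContinuousOn u {x | r₀ < ‖x‖})
    (hV : VanishesToInfiniteOrderAtInfinity u) (hb : r₀ ^ 2 < b) (m : ℕ) :
    MemLp ({x | b ≤ ‖x‖ ^ 2}.indicator fun x => (1 + ‖x‖) ^ m * u x) 2 := by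
  have hclosed : IsClosed {x : EuclideanSpace ℝ (Fin n) | b ≤ ‖x‖ ^ 2} :=
    isClosed_le continuous_const (by fun_prop)
  have hcont : ContinuousOn (fun x => (1 + ‖x‖) ^ m * u x)
      {x : EuclideanSpace ℝ (Fin n) | b ≤ ‖x‖ ^ 2} :=
    ContinuousOn.mul (by fun_prop) (hu.mono (setOf_le_norm_sq_subset hb))
  rw [memLp_indicator_iff_restrict hclosed.measurableSet, memLp_two_iff_integrable_sq
    (hcont.aestronglyMeasurable hclosed.measurableSet)]
  obtain ⟨N, hN⟩ := hV.exists_setLIntegral_lt_top (2 * m)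
  have hcover : {x : EuclideanSpace ℝ (Fin n) | b ≤ ‖x‖ ^ 2} ⊆
      {x | b ≤ ‖x‖ ^ 2} ∩ closedBall 0 N ∪ {x | b ≤ ‖x‖ ^ 2} ∩ {x | (N : ℝ) < ‖x‖} := by
    rw [← Set.inter_union_distrib_left]
    exact fun x hx => ⟨hx, by simpa using le_or_gt ‖x‖ N⟩
  refine IntegrableOn.mono_set (.union ?_ ?_) hcover
  · exact ((hcont.mono Set.inter_subset_left).pow 2).integrableOn_compact
      ((isCompact_closedBall 0 _).inter_left hclosed)
  · refine ⟨((hcont.mono Set.inter_subset_left).pow 2).aestronglyMeasurable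
      (hclosed.measurableSet.inter (measurableSet_lt measurable_const measurable_norm)), ?_⟩
    rw [hasFiniteIntegral_iff_ofReal (.of_forall fun x => sq_nonneg _)]
    refine (lintegral_mono_set Set.inter_subset_right).trans_lt (hN.trans_eq' ?_)
    refine lintegral_congr fun x => ?_
    rw [mul_pow, sq_abs, ← pow_mul, mul_comm m]

lemma hasFiniteMoments_indicator {r₀ b : ℝ} (hu : ContinuousOn u {x | r₀ < ‖x‖})
    (hV : VanishesToInfiniteOrderAtInfinity u) (hb : r₀ ^ 2 < b) :
    HasFiniteMoments ({x | b ≤ ‖x‖ ^ 2}.indicator u) := by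
  intro m
  have hdecay : MemLp (fun x : EuclideanSpace ℝ (Fin n) => ((1 + ‖x‖) ^ (n + 1))⁻¹) 2 := by
    have hcont : Continuous fun x : EuclideanSpace ℝ (Fin n) => ((1 + ‖x‖) ^ (n + 1))⁻¹ :=
      ((continuous_const.add continuous_norm).pow _).inv₀ fun x =>
        (by positivity : (0 : ℝ) < (1 + ‖x‖) ^ (n + 1)).ne'
    rw [memLp_two_iff_integrable_sq hcont.aestronglyMeasurable]
    refine (integrable_one_add_norm (μ := volume) (r := (2 * (n + 1) : ℕ)) ?_).congr
      (.of_forall fun x => ?_)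
    · rw [finrank_euclideanSpace_fin]
      exact_mod_cast (by lia : n < 2 * (n + 1))
    · dsimp only
      rw [Real.rpow_neg (by positivity), Real.rpow_natCast, inv_pow, ← pow_mul, mul_comm 2]
  -- Cauchy–Schwarz against a power of `1 + ‖x‖` that is square integrable.
  refine ((memLp_two_indicator_of_tail hu hV hb (m + (n + 1))).integrable_mul hdecay).congr
    (.of_forall fun x => ?_)
  by_cases hx : x ∈ {x : EuclideanSpace ℝ (Fin n) | b ≤ ‖x‖ ^ 2}
  · simp only [Pi.mul_apply, Set.indicator_of_mem hx]
    field_simp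
    ring
  · simp [Set.indicator_of_notMem hx]

end Moments

section TemperateTestFunctions

open scoped Laplacian ContDiff

lemma norm_iteratedFDeriv_comp_smul_le {E : Type*} [NormedAddCommGroup E] [NormedSpace ℝ E]
    {χ : E → ℝ} {j l : ℕ} {C ε : ℝ} (hχ : ContDiff ℝ j χ) (hε : |ε| ≤ 1)
    (hC : ∀ x, ‖iteratedFDeriv ℝ j χ x‖ ≤ C * (1 + ‖x‖) ^ l) (x : E) :
    ‖iteratedFDeriv ℝ j (fun y => χ (ε • y)) x‖ ≤ C * (1 + ‖x‖) ^ l := by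
  have hC0 : 0 ≤ C := (norm_nonneg _).trans (by simpa using hC 0)
  have hεx : ‖ε • x‖ ≤ ‖x‖ := by
    rw [norm_smul]
    exact mul_le_of_le_one_left (norm_nonneg x) hε
  rw [iteratedFDeriv_comp_const_smul ε hχ, norm_smul, norm_pow]
  calc ‖ε‖ ^ j * ‖iteratedFDeriv ℝ j χ (ε • x)‖ ≤ 1 * (C * (1 + ‖ε • x‖) ^ l) := by
        gcongr
        · exact pow_le_one₀ (norm_nonneg ε) hε
        · exact hC _
    _ ≤ C * (1 + ‖x‖) ^ l := by rw [one_mul]; gcongr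

variable {E : Type*} [NormedAddCommGroup E] [InnerProductSpace ℝ E] [FiniteDimensional ℝ E]

lemma continuous_laplacian {f : E → ℝ} (hf : ContDiff ℝ 2 f) : Continuous (Δ f) := by
  rw [laplacian_eq_iteratedFDeriv_stdOrthonormalBasis f]
  have := hf.continuous_iteratedFDeriv le_rfl
  fun_prop

lemma exists_forall_norm_laplacian_mul_comp_smul_le {ψ χ : E → ℝ} (hψ : ψ.HasTemperateGrowth)
    (hχ : χ.HasTemperateGrowth) :
    ∃ (m : ℕ) (C : ℝ), ∀ ε : ℝ, |ε| ≤ 1 → ∀ x,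
      ‖Δ (fun y => ψ y * χ (ε • y)) x‖ ≤ C * (1 + ‖x‖) ^ m := by
  obtain ⟨k, A, _, hψk⟩ := hψ.norm_iteratedFDeriv_le_uniform 2
  obtain ⟨l, B, _, hχl⟩ := hχ.norm_iteratedFDeriv_le_uniform 2
  refine ⟨k + l, Module.finrank ℝ E * (4 * A * B), fun ε hε x => ?_⟩
  have hprod (i : ℕ) (hi : i ≤ 2) : ‖iteratedFDeriv ℝ i ψ x‖ *
      ‖iteratedFDeriv ℝ (2 - i) (fun y => χ (ε • y)) x‖ ≤ A * B * (1 + ‖x‖) ^ (k + l) := by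
    calc _ ≤ A * (1 + ‖x‖) ^ k * (B * (1 + ‖x‖) ^ l) := by
          gcongr
          · exact hψk i hi x
          · exact norm_iteratedFDeriv_comp_smul_le (contDiff_infty.1 hχ.1 _) hε
              (hχl _ (Nat.sub_le 2 i)) x
      _ = _ := by ring
  have hsecond : ‖iteratedFDeriv ℝ 2 (fun y => ψ y * χ (ε • y)) x‖ ≤
      4 * A * B * (1 + ‖x‖) ^ (k + l) := by
    calc _ ≤ ∑ i ∈ Finset.range 3, (Nat.choose 2 i : ℝ) * ‖iteratedFDeriv ℝ i ψ x‖ *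
            ‖iteratedFDeriv ℝ (2 - i) (fun y => χ (ε • y)) x‖ :=
          norm_iteratedFDeriv_mul_le (hψ.1.of_le ENat.LEInfty.out)
            ((hχ.1.fun_comp (contDiff_const_smul ε)).of_le ENat.LEInfty.out) x le_rfl
      _ ≤ ∑ i ∈ Finset.range 3, (Nat.choose 2 i : ℝ) * (A * B * (1 + ‖x‖) ^ (k + l)) := by
          refine Finset.sum_le_sum fun i hi => ?_
          rw [mul_assoc]
          exact mul_le_mul_of_nonneg_left (hprod i (Finset.mem_range_succ_iff.1 hi))
            (Nat.cast_nonneg _)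
      _ = 4 * A * B * (1 + ‖x‖) ^ (k + l) := by
          simp only [Finset.sum_range_succ, Finset.sum_range_zero, Nat.choose]
          push_cast
          ring
  calc _ ≤ Module.finrank ℝ E * ‖iteratedFDeriv ℝ 2 (fun y => ψ y * χ (ε • y)) x‖ :=
        abs_laplacian_le _ _
    _ ≤ Module.finrank ℝ E * (4 * A * B * (1 + ‖x‖) ^ (k + l)) := by gcongr
    _ = _ := by ring

lemma eventually_laplacian_mul_comp_smul_eq {ψ χ : E → ℝ} (hχ : χ =ᶠ[𝓝 0] 1) (x : E) :
    ∀ᶠ ε : ℝ in 𝓝 0, Δ (fun y => ψ y * χ (ε • y)) x = Δ ψ x := by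
  have hsmul : Tendsto (fun q : ℝ × E => q.1 • q.2) (𝓝 (0, x)) (𝓝 0) := by
    simpa using (continuous_smul (M := ℝ)).tendsto ((0 : ℝ), x)
  filter_upwards [(hsmul.eventually hχ).curry_nhds] with ε hε
  refine (laplacian_congr_nhds ?_).self_of_nhds
  filter_upwards [hε] with y hy
  simp [hy]

variable [MeasureSpace E] [BorelSpace E]

/-- The weak form of harmonicity on `b ≤ ‖x‖ ^ 2`, tested against functions which may have
polynomial growth at infinity but vanish for `‖x‖ ^ 2 < b`. -/
def AnnihilatesLaplacians (v : E → ℝ) (b : ℝ) : Prop :=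
  ∀ ψ : E → ℝ, ψ.HasTemperateGrowth → (∀ x, ‖x‖ ^ 2 < b → ψ x = 0) → ∫ x, v x * Δ ψ x = 0

lemma HasFiniteMoments.annihilatesLaplacians {v : E → ℝ} (hv : HasFiniteMoments v) {b : ℝ}
    (hcompact : ∀ ψ : E → ℝ, ContDiff ℝ ∞ ψ → HasCompactSupport ψ →
      (∀ x, ‖x‖ ^ 2 < b → ψ x = 0) → ∫ x, v x * Δ ψ x = 0) :
    AnnihilatesLaplacians v b := by
  intro ψ hψ hψb
  let χ : ContDiffBump (0 : E) := ⟨1, 2, one_pos, one_lt_two⟩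
  have hψχ (ε : ℝ) : ContDiff ℝ ∞ fun y => ψ y * χ (ε • y) :=
    hψ.1.mul (χ.contDiff.comp (contDiff_const_smul ε))
  obtain ⟨m, C, hC⟩ := exists_forall_norm_laplacian_mul_comp_smul_le hψ
    (χ.hasCompactSupport.hasTemperateGrowth χ.contDiff)
  have hlim : Tendsto (fun ε : ℝ => ∫ x, v x * Δ (fun y => ψ y * χ (ε • y)) x) (𝓝[≠] 0)
      (𝓝 (∫ x, v x * Δ ψ x)) := by
    refine tendsto_integral_filter_of_dominated_convergence
      (fun x => C * ‖(1 + ‖x‖) ^ m * v x‖) (.of_forall fun ε => ?_) ?_ ((hv m).norm.const_mul C)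
      (.of_forall fun x => ?_)
    · exact hv.aestronglyMeasurable.mul
        (continuous_laplacian ((hψχ ε).of_le ENat.LEInfty.out)).aestronglyMeasurable
    · filter_upwards [nhdsWithin_le_nhds (closedBall_mem_nhds (0 : ℝ) one_pos)] with ε hε
      exact .of_forall fun x => norm_mul_le_of_norm_le (hC ε (by simpa using hε) x)
    · refine tendsto_nhds_of_eventually_eq (nhdsWithin_le_nhds ?_)
      filter_upwards [eventually_laplacian_mul_comp_smul_eq χ.eventuallyEq_one x] with ε hε
      rw [hε]
  refine tendsto_nhds_unique hlim (tendsto_const_nhds.congr' ?_)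
  filter_upwards [self_mem_nhdsWithin] with ε (hε : ε ≠ 0)
  refine (hcompact _ (hψχ ε) (χ.hasCompactSupport.comp_smul hε).mul_left fun x hx => ?_).symm
  rw [hψb x hx, zero_mul]

end TemperateTestFunctions

section RadialWeights

open scoped ContDiff

lemma hasTemperateGrowth_deriv {h : ℝ → ℝ} (hh : h.HasTemperateGrowth) :
    (deriv h).HasTemperateGrowth := by
  refine ⟨(contDiff_infty_iff_deriv.1 hh.1).2, fun n => ?_⟩
  simpa only [norm_iteratedFDeriv_eq_norm_iteratedDeriv, iteratedDeriv_succ'] using hh.2 (n + 1)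

lemma hasTemperateGrowth_intervalIntegral {h : ℝ → ℝ} (hh : h.HasTemperateGrowth) (b : ℝ) :
    (fun s => ∫ t in b..s, h t).HasTemperateGrowth := by
  have hderiv (s : ℝ) : HasDerivAt (fun s => ∫ t in b..s, h t) (h s) s :=
    hh.1.continuous.integral_hasStrictDerivAt b s |>.hasDerivAt
  have hfderiv : fderiv ℝ (fun s => ∫ t in b..s, h t) =
      fun s => ContinuousLinearMap.toSpanSingletonCLE (h s) :=
    funext fun s => (hderiv s).hasFDerivAt.fderiv
  obtain ⟨k, C, hC0, hC⟩ := hh.norm_iteratedFDeriv_le_uniform 0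
  have hbound (s : ℝ) : ∀ t ∈ Set.uIoc b s, ‖h t‖ ≤ C * ((1 + |b|) * (1 + |s|)) ^ k := by
    intro t ht
    have htbs : |t| ≤ |b| + |s| := by
      have hmem := Set.uIoc_subset_uIcc ht
      rw [Set.mem_uIcc] at hmem
      grind
    calc ‖h t‖ ≤ C * (1 + ‖t‖) ^ k := by simpa using hC 0 le_rfl t
      _ ≤ _ := by
        gcongr
        rw [Real.norm_eq_abs]
        nlinarith [abs_nonneg b, abs_nonneg s]
  refine .of_fderiv (k := k + 1) (C := C * (1 + |b|) ^ (k + 1)) (by rw [hfderiv]; fun_prop)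
    (fun s => (hderiv s).differentiableAt) fun s => ?_
  have hlen : |s - b| ≤ (1 + |b|) * (1 + |s|) := by
    nlinarith [abs_sub s b, abs_nonneg b, abs_nonneg s]
  calc _ ≤ C * ((1 + |b|) * (1 + |s|)) ^ k * |s - b| :=
        intervalIntegral.norm_integral_le_of_norm_le_const (hbound s)
    _ ≤ C * ((1 + |b|) * (1 + |s|)) ^ k * ((1 + |b|) * (1 + |s|)) := by gcongr
    _ = _ := by rw [Real.norm_eq_abs, mul_pow]; ring

lemma exists_temperate_antideriv {h : ℝ → ℝ} {b : ℝ} (hh : h.HasTemperateGrowth)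
    (hb : ∀ s ≤ b, h s = 0) :
    ∃ g : ℝ → ℝ, g.HasTemperateGrowth ∧ (∀ s ≤ b, g s = 0) ∧ deriv g = h := by
  refine ⟨fun s => ∫ t in b..s, h t, hasTemperateGrowth_intervalIntegral hh b, fun s hs => ?_,
    funext (hh.1.continuous.deriv_integral h b)⟩
  calc ∫ t in b..s, h t = ∫ _t in b..s, 0 := by
        refine intervalIntegral.integral_congr fun t ht => hb t ?_
        rw [Set.uIcc_of_ge hs] at ht
        exact ht.2
    _ = 0 := intervalIntegral.integral_zero

lemma eq_zero_of_mul_hasDerivAt_eq_neg {Φ Φ' : ℝ → ℝ} {α T : ℝ} (hα : 0 ≤ α) (hT : 0 ≤ T)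
    (hcont : ContinuousOn Φ (Set.Icc 0 T)) (hderiv : ∀ t ∈ Set.Ioo 0 T, HasDerivAt Φ (Φ' t) t)
    (hode : ∀ t ∈ Set.Ioo 0 T, t * Φ' t = -α * Φ t) (h0 : Φ 0 = 0) : Φ T = 0 := by
  have hanti : AntitoneOn (fun t => Φ t ^ 2) (Set.Icc 0 T) := by
    refine antitoneOn_of_hasDerivWithinAt_nonpos (convex_Icc 0 T) (hcont.pow 2)
      (f' := fun t => 2 * Φ t * Φ' t) (fun t ht => ?_) fun t ht => ?_ <;> rw [interior_Icc] at ht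
    · simpa using ((hderiv t ht).fun_pow 2).hasDerivWithinAt
    · refine nonpos_of_mul_nonpos_right (a := t) ?_ ht.1
      calc t * (2 * Φ t * Φ' t) = 2 * Φ t * (t * Φ' t) := by ring
        _ = -(2 * α * Φ t ^ 2) := by rw [hode t ht]; ring
        _ ≤ 0 := neg_nonpos.2 (by positivity)
  have hle : Φ T ^ 2 ≤ Φ 0 ^ 2 := hanti ⟨le_rfl, hT⟩ ⟨hT, le_rfl⟩ hT
  rw [h0, zero_pow two_ne_zero] at hle
  exact pow_eq_zero_iff two_ne_zero |>.1 (hle.antisymm (sq_nonneg _))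

lemma exists_forall_norm_sq_mul_comp_mul_norm_sq_le {E : Type*} [SeminormedAddCommGroup E]
    {g : ℝ → ℝ} (hg : g.HasTemperateGrowth) (T : ℝ) :
    ∃ (m : ℕ) (C : ℝ), ∀ τ : ℝ, |τ| ≤ T → ∀ x : E,
      ‖‖x‖ ^ 2 * g (τ * ‖x‖ ^ 2)‖ ≤ C * (1 + ‖x‖) ^ m := by
  obtain ⟨k, C, hC0, hC⟩ := hg.norm_iteratedFDeriv_le_uniform 0
  refine ⟨2 * k + 2, C * (1 + T) ^ k, fun τ hτ x => ?_⟩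
  have hT : 0 ≤ T := (abs_nonneg τ).trans hτ
  have harg : 1 + ‖τ * ‖x‖ ^ 2‖ ≤ (1 + T) * (1 + ‖x‖) ^ 2 := by
    rw [norm_mul, norm_pow, norm_norm, Real.norm_eq_abs]
    nlinarith [norm_nonneg x, mul_le_mul_of_nonneg_right hτ (sq_nonneg ‖x‖),
      mul_nonneg hT (norm_nonneg x)]
  calc ‖‖x‖ ^ 2 * g (τ * ‖x‖ ^ 2)‖ = ‖x‖ ^ 2 * ‖g (τ * ‖x‖ ^ 2)‖ := by simp
    _ ≤ (1 + ‖x‖) ^ 2 * (C * ((1 + T) * (1 + ‖x‖) ^ 2) ^ k) := by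
        gcongr
        · linarith
        · calc ‖g (τ * ‖x‖ ^ 2)‖ ≤ C * (1 + ‖τ * ‖x‖ ^ 2‖) ^ k := by
                simpa only [norm_iteratedFDeriv_zero] using hC 0 le_rfl (τ * ‖x‖ ^ 2)
            _ ≤ _ := by gcongr
    _ = C * (1 + T) ^ k * (1 + ‖x‖) ^ (2 * k + 2) := by rw [mul_pow, ← pow_mul]; ring

variable {E : Type*} [NormedAddCommGroup E] [InnerProductSpace ℝ E] [MeasureSpace E] [BorelSpace E]

namespace HasFiniteMoments

variable {w : E → ℝ} (hw : HasFiniteMoments w) {h : ℝ → ℝ} (hh : h.HasTemperateGrowth)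
include hw hh

lemma hasDerivAt_integral_mul_comp_mul_norm_sq (t : ℝ) :
    HasDerivAt (fun t => ∫ x, w x * h (t * ‖x‖ ^ 2))
      (∫ x, w x * (‖x‖ ^ 2 * deriv h (t * ‖x‖ ^ 2))) t := by
  have hh' := hasTemperateGrowth_deriv hh
  obtain ⟨m, C, hC⟩ := exists_forall_norm_sq_mul_comp_mul_norm_sq_le (E := E)
    hh' (1 + |t|)
  have hτ : ∀ τ ∈ ball t 1, |τ| ≤ 1 + |t| := by
    intro τ hτ
    rw [mem_ball, Real.dist_eq] at hτ
    linarith [abs_sub_abs_le_abs_sub τ t]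
  refine (hasDerivAt_integral_of_dominated_loc_of_deriv_le (ball_mem_nhds t one_pos)
    (F := fun τ x => w x * h (τ * ‖x‖ ^ 2))
    (F' := fun τ x => w x * (‖x‖ ^ 2 * deriv h (τ * ‖x‖ ^ 2)))
    (bound := fun x => C * ‖(1 + ‖x‖) ^ m * w x‖)
    (.of_forall fun τ => ?_) ?_ ?_ (.of_forall fun x τ hmem => ?_)
    ((hw m).norm.const_mul C) (.of_forall fun x τ _ => ?_)).2
  · exact (hw.integrable_mul_temperate (by fun_prop)).aestronglyMeasurable
  · exact hw.integrable_mul_temperate (by fun_prop)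
  · exact (hw.integrable_mul_temperate (by fun_prop)).aestronglyMeasurable
  · exact norm_mul_le_of_norm_le (φ := fun x => ‖x‖ ^ 2 * deriv h (τ * ‖x‖ ^ 2))
      (hC τ (hτ τ hmem) x)
  · have hs := (hh.1.differentiable (by simp) (τ * ‖x‖ ^ 2)).hasDerivAt
    simpa [mul_comm (‖x‖ ^ 2)] using!
      (hs.comp τ ((hasDerivAt_id τ).mul_const (‖x‖ ^ 2))).const_mul (w x)

-- Applied to the dilates `h (t * ·)`, the Euler identity says that `Φ t = ∫ w h(t ‖x‖ ^ 2)` solves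
-- `t * Φ' t = -α * Φ t` with `Φ 0 = 0`.
lemma integral_mul_comp_norm_sq_eq_zero {α b : ℝ} (hα : 0 ≤ α) (hb : 0 ≤ b)
    (heuler : ∀ h : ℝ → ℝ, h.HasTemperateGrowth → (∀ s ≤ b, h s = 0) →
      ∫ x, w x * (‖x‖ ^ 2 * deriv h (‖x‖ ^ 2) + α * h (‖x‖ ^ 2)) = 0)
    (hhb : ∀ s ≤ b, h s = 0) : ∫ x, w x * h (‖x‖ ^ 2) = 0 := by
  have hΦ := hw.hasDerivAt_integral_mul_comp_mul_norm_sq hh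
  have hode : ∀ t ∈ Set.Ioo (0 : ℝ) 1,
      t * ∫ x, w x * (‖x‖ ^ 2 * deriv h (t * ‖x‖ ^ 2)) = -α * ∫ x, w x * h (t * ‖x‖ ^ 2) := by
    intro t ⟨ht0, ht1⟩
    have hdilate := heuler (fun s => h (t * s)) (by fun_prop) fun s hs => hhb _ (by nlinarith)
    have hsplit : ∀ x, w x * (‖x‖ ^ 2 * deriv (fun s => h (t * s)) (‖x‖ ^ 2) +
        α * h (t * ‖x‖ ^ 2)) = t * (w x * (‖x‖ ^ 2 * deriv h (t * ‖x‖ ^ 2))) +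
          α * (w x * h (t * ‖x‖ ^ 2)) := by
      intro x
      rw [deriv_comp_mul_left, smul_eq_mul]
      ring
    simp only [hsplit] at hdilate
    rw [integral_add, integral_const_mul, integral_const_mul] at hdilate
    · linarith
    · have hh' := hasTemperateGrowth_deriv hh
      exact (hw.integrable_mul_temperate (by fun_prop)).const_mul t
    · exact (hw.integrable_mul_temperate (by fun_prop)).const_mul α
  simpa using eq_zero_of_mul_hasDerivAt_eq_neg hα zero_le_one
    (fun t _ => (hΦ t).continuousAt.continuousWithinAt) (fun t _ => hΦ t) hode (by simp [hhb 0 hb])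

end HasFiniteMoments

end RadialWeights

section PolynomialMoments

open MvPolynomial
open scoped Laplacian ContDiff

lemma exists_mvPolynomial_near {ι : Type*} {K : Set (EuclideanSpace ℝ ι)} (hK : IsCompact K)
    {w : EuclideanSpace ℝ ι → ℝ} (hw : ContinuousOn w K) {ε : ℝ} (hε : 0 < ε) :
    ∃ p : MvPolynomial ι ℝ, ∀ x ∈ K, |eval x.ofLp p - w x| < ε := by
  have : CompactSpace K := isCompact_iff_compactSpace.1 hK
  let X : ι → C(K, ℝ) := fun i => ⟨fun x => x.1.ofLp i, by fun_prop⟩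
  have hX (p : MvPolynomial ι ℝ) (x : K) : aeval X p x = eval x.1.ofLp p := by
    induction p using MvPolynomial.induction_on with
    | C c => simp
    | add p q hp hq => simp [hp, hq]
    | mul_X p j hp => simp [hp, X]
  have hsep : (aeval (R := ℝ) X).range.SeparatesPoints := by
    intro x y hxy
    obtain ⟨i, hi⟩ : ∃ i, x.1.ofLp i ≠ y.1.ofLp i := by
      by_contra! h
      exact hxy (Subtype.ext (PiLp.ext h))
    exact ⟨X i, ⟨X i, ⟨MvPolynomial.X i, by simp⟩, rfl⟩, hi⟩
  obtain ⟨⟨g, p, rfl⟩, hg⟩ :=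
    ContinuousMap.exists_mem_subalgebra_near_continuous_of_separatesPoints
      (aeval (R := ℝ) X).range hsep (K.domRestrict w) hw.domRestrict ε hε
  exact ⟨p, fun x hx => by simpa [hX] using hg ⟨x, hx⟩⟩

variable {ι : Type*} [Fintype ι] {v : EuclideanSpace ℝ ι → ℝ} {b : ℝ} {k : ℕ}
  {p : MvPolynomial ι ℝ}

lemma HasFiniteMoments.mul_eval (hv : HasFiniteMoments v) (p : MvPolynomial ι ℝ) :
    HasFiniteMoments fun x => v x * eval x.ofLp p :=
  hv.mul_temperate (hasTemperateGrowth_eval p)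

namespace AnnihilatesLaplacians

lemma integral_mul_eval_mul_euler_eq_zero (hann : AnnihilatesLaplacians v b)
    (hv : HasFiniteMoments v) (hp : p.IsHomogeneous k)
    (hlap : ∀ g : ℝ → ℝ, g.HasTemperateGrowth → (∀ s ≤ b, g s = 0) →
      ∫ x, v x * eval x.ofLp (∑ i, pderiv i (pderiv i p)) * g (‖x‖ ^ 2) = 0)
    {h : ℝ → ℝ} (hh : h.HasTemperateGrowth) (hhb : ∀ s ≤ b, h s = 0) :
    ∫ x, v x * eval x.ofLp p *
      (‖x‖ ^ 2 * deriv h (‖x‖ ^ 2) + (k + Fintype.card ι / 2) * h (‖x‖ ^ 2)) = 0 := by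
  obtain ⟨g, hg, hgb, rfl⟩ := exists_temperate_antideriv hh hhb
  have hh' := hasTemperateGrowth_deriv hh
  have hP := hasTemperateGrowth_eval p
  have hsum := hann (fun x => eval x.ofLp p * g (‖x‖ ^ 2)) (by fun_prop)
    fun x hx => by rw [hgb _ hx.le, mul_zero]
  have hsplit : ∀ x : EuclideanSpace ℝ ι,
      v x * Δ (fun y : EuclideanSpace ℝ ι => eval y.ofLp p * g (‖y‖ ^ 2)) x =
        4 * (v x * eval x.ofLp p * (‖x‖ ^ 2 * deriv (deriv g) (‖x‖ ^ 2) +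
          (k + Fintype.card ι / 2) * deriv g (‖x‖ ^ 2))) +
        v x * eval x.ofLp (∑ i, pderiv i (pderiv i p)) * g (‖x‖ ^ 2) := by
    intro x
    rw [laplacian_eval_mul_comp_norm_sq hp (hg.1.of_le ENat.LEInfty.out)]
    ring
  simp only [hsplit] at hsum
  rw [integral_add, integral_const_mul, hlap g hg hgb] at hsum
  · linarith
  · exact ((hv.mul_eval p).integrable_mul_temperate (by fun_prop)).const_mul 4
  · exact (hv.mul_eval _).integrable_mul_temperate (by fun_prop)

lemma integral_mul_eval_mul_comp_norm_sq_eq_zero (hann : AnnihilatesLaplacians v b)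
    (hv : HasFiniteMoments v) (hb : 0 ≤ b) (hp : p.IsHomogeneous k)
    {h : ℝ → ℝ} (hh : h.HasTemperateGrowth) (hhb : ∀ s ≤ b, h s = 0) :
    ∫ x, v x * eval x.ofLp p * h (‖x‖ ^ 2) = 0 := by
  induction k using Nat.strong_induction_on generalizing p h with
  | _ k ih =>
    refine (hv.mul_eval p).integral_mul_comp_norm_sq_eq_zero hh (by positivity) hb
      (fun h hh hhb => hann.integral_mul_eval_mul_euler_eq_zero hv hp (fun g hg hgb => ?_) hh hhb)
      hhb
    rcases k.eq_zero_or_pos with rfl | hk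
    · rw [totalDegree_eq_zero_iff_eq_C.1 (Nat.le_zero.1 hp.totalDegree_le)]
      simp
    · exact ih (k - 1 - 1) (by lia) (.sum _ _ _ fun i _ => hp.pderiv.pderiv) hg hgb

end AnnihilatesLaplacians

section CompactSupport

variable {w : EuclideanSpace ℝ ι → ℝ} (hw : Continuous w) (hwc : HasCompactSupport w)
include hw hwc

lemma integral_sq_le_of_integral_mul_eval_eq_zero
    (hint : ∀ p : MvPolynomial ι ℝ, ∫ x, w x * eval x.ofLp p = 0) {ε : ℝ} (hε : 0 < ε) :
    ∫ x, w x ^ 2 ≤ ε * ∫ x, |w x| := by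
  have hprod {f : EuclideanSpace ℝ ι → ℝ} (hf : Continuous f) : Integrable fun x => w x * f x :=
    (hw.mul hf).integrable_of_hasCompactSupport hwc.mul_right
  obtain ⟨p, hp⟩ := exists_mvPolynomial_near hwc hw.continuousOn hε
  have hP := (hasTemperateGrowth_eval p).1.continuous
  calc ∫ x, w x ^ 2 = ∫ x, (w x * w x - w x * eval x.ofLp p) := by
        rw [integral_sub (hprod hw) (hprod hP), hint p, sub_zero]
        simp only [sq]
    _ ≤ ∫ x, ε * |w x| := by
        refine integral_mono ((hprod hw).sub (hprod hP))
          ((hw.integrable_of_hasCompactSupport hwc).abs.const_mul ε) fun x => ?_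
        by_cases hx : x ∈ tsupport w
        · calc w x * w x - w x * eval x.ofLp p = -(w x * (eval x.ofLp p - w x)) := by ring
            _ ≤ |w x| * |eval x.ofLp p - w x| := (neg_le_abs _).trans_eq (abs_mul _ _)
            _ ≤ |w x| * ε := by
                gcongr
                exact (hp x hx).le
            _ = ε * |w x| := mul_comm _ _
        · simp [image_eq_zero_of_notMem_tsupport hx]
    _ = ε * ∫ x, |w x| := integral_const_mul ε _

lemma eq_zero_of_integral_mul_eval_eq_zero
    (hint : ∀ p : MvPolynomial ι ℝ, ∫ x, w x * eval x.ofLp p = 0) : w = 0 := by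
  by_contra! hne
  obtain ⟨x, hx⟩ := Function.ne_iff.1 hne
  have hsupp : HasCompactSupport fun y => w y ^ 2 :=
    hwc.comp_left (g := fun r : ℝ => r ^ 2) (zero_pow two_ne_zero)
  have hpos : 0 < ∫ y, w y ^ 2 :=
    Continuous.integral_pos_of_hasCompactSupport_nonneg_nonzero (x := x) (by fun_prop) hsupp
      (fun y => sq_nonneg (w y)) (pow_ne_zero 2 hx)
  have hlim : Tendsto (fun ε => ε * ∫ x, |w x|) (𝓝[>] 0) (𝓝 0) := by
    have hid : Tendsto (fun ε : ℝ => ε) (𝓝[>] 0) (𝓝 0) := nhdsWithin_le_nhds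
    simpa using hid.mul_const (∫ x, |w x|)
  refine hpos.not_ge (ge_of_tendsto hlim ?_)
  filter_upwards [self_mem_nhdsWithin] with ε hε
    using integral_sq_le_of_integral_mul_eval_eq_zero hw hwc hint hε

end CompactSupport

lemma AnnihilatesLaplacians.mul_comp_norm_sq_eq_zero (hann : AnnihilatesLaplacians v b)
    (hv : HasFiniteMoments v) (hb : 0 ≤ b) {h : ℝ → ℝ} (hh : h.HasTemperateGrowth)
    (hhb : ∀ s ≤ b, h s = 0) (hcont : Continuous fun x => v x * h (‖x‖ ^ 2))
    (hcompact : HasCompactSupport fun x => v x * h (‖x‖ ^ 2)) :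
    (fun x => v x * h (‖x‖ ^ 2)) = 0 := by
  refine eq_zero_of_integral_mul_eval_eq_zero hcont hcompact fun p => ?_
  rw [← p.sum_homogeneousComponent]
  simp only [mul_right_comm _ (h _), map_sum, Finset.mul_sum, Finset.sum_mul]
  rw [integral_finsetSum _ fun k _ => (hv.mul_eval _).integrable_mul_temperate (by fun_prop)]
  exact Finset.sum_eq_zero fun k _ => hann.integral_mul_eval_mul_comp_norm_sq_eq_zero hv hb
    (homogeneousComponent_isHomogeneous k p) hh hhb

end PolynomialMoments

section UniqueContinuation

open scoped Laplacian

lemma hasCompactSupport_comp_norm_sq {E F : Type*} [SeminormedAddGroup E] [ProperSpace E]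
    [Zero F] {h : ℝ → F} (hh : HasCompactSupport h) :
    HasCompactSupport fun x : E => h (‖x‖ ^ 2) := by
  rw [hasCompactSupport_iff_eventuallyEq, coclosedCompact_eq_cocompact] at hh ⊢
  have hlim : Tendsto (fun x : E => ‖x‖ ^ 2) (cocompact E) (cocompact ℝ) :=
    ((tendsto_pow_atTop two_ne_zero).comp tendsto_norm_cocompact_atTop).mono_right
      atTop_le_cocompact
  exact hlim.eventually hh

lemma tsupport_subset_of_norm_sq_lt {E F : Type*} [SeminormedAddGroup E] [Zero F]
    {ψ : E → F} {b : ℝ} (hψ : ∀ x, ‖x‖ ^ 2 < b → ψ x = 0) :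
    tsupport ψ ⊆ {x | b ≤ ‖x‖ ^ 2} :=
  closure_minimal (fun x hx => le_of_not_gt fun hlt => hx (hψ x hlt))
    (isClosed_le continuous_const (by fun_prop))

lemma isOpen_setOf_lt_norm {E : Type*} [SeminormedAddGroup E] (r₀ : ℝ) :
    IsOpen {x : E | r₀ < ‖x‖} :=
  isOpen_lt continuous_const continuous_norm

variable {n : ℕ} {r₀ b : ℝ} {u : EuclideanSpace ℝ (Fin n) → ℝ}

lemma annihilatesLaplacians_indicator (hu : HarmonicOnNhd u {x | r₀ < ‖x‖})
    (hV : VanishesToInfiniteOrderAtInfinity u) (hb : r₀ ^ 2 < b) :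
    AnnihilatesLaplacians ({x | b ≤ ‖x‖ ^ 2}.indicator u) b := by
  refine (hasFiniteMoments_indicator hu.contDiffOn.continuousOn hV hb).annihilatesLaplacians
    fun ψ hψ hψc hψb => ?_
  have hsupp := tsupport_subset_of_norm_sq_lt hψb
  rw [← integral_mul_laplacian_eq_zero_of_harmonicOnNhd (μ := volume) (isOpen_setOf_lt_norm r₀) hu
    (hψ.of_le ENat.LEInfty.out) hψc (hsupp.trans (setOf_le_norm_sq_subset hb))]
  refine integral_congr_ae (.of_forall fun x => ?_)
  by_cases hx : x ∈ {x | b ≤ ‖x‖ ^ 2}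
  · simp only [Set.indicator_of_mem hx]
  · have hψx : ψ =ᶠ[𝓝 x] fun _ => 0 := notMem_tsupport_iff_eventuallyEq.1 fun h => hx (hsupp h)
    simp only [(laplacian_congr_nhds hψx).self_of_nhds, laplacian_const, Pi.zero_apply, mul_zero]

theorem VanishesToInfiniteOrderAtInfinity.eq_zero_of_lt_norm
    (hV : VanishesToInfiniteOrderAtInfinity u) (hr₀ : 0 ≤ r₀)
    (hu : HarmonicOnNhd u {x | r₀ < ‖x‖}) {x₀ : EuclideanSpace ℝ (Fin n)}
    (hx₀ : r₀ < ‖x₀‖) : u x₀ = 0 := by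
  obtain ⟨b, hb, hbx⟩ := exists_between (show r₀ ^ 2 < ‖x₀‖ ^ 2 by gcongr)
  let h : ContDiffBump (‖x₀‖ ^ 2) :=
    ⟨(‖x₀‖ ^ 2 - b) / 2, ‖x₀‖ ^ 2 - b, half_pos (sub_pos.2 hbx), half_lt_self (sub_pos.2 hbx)⟩
  have hhb : ∀ s ≤ b, h s = 0 := fun s hs => h.zero_of_le_dist <| by
    rw [dist_comm, Real.dist_eq]
    exact (sub_le_sub_left hs _).trans (le_abs_self _)
  have hsupp : tsupport (fun x : EuclideanSpace ℝ (Fin n) => h (‖x‖ ^ 2)) ⊆ {x | b ≤ ‖x‖ ^ 2} :=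
    tsupport_subset_of_norm_sq_lt fun x hx => hhb _ hx.le
  have hindicator : (fun x => {x | b ≤ ‖x‖ ^ 2}.indicator u x * h (‖x‖ ^ 2)) =
      fun x => u x * h (‖x‖ ^ 2) := by
    funext x
    by_cases hx : b ≤ ‖x‖ ^ 2
    · rw [Set.indicator_of_mem (s := {x | b ≤ ‖x‖ ^ 2}) hx]
    · rw [hhb _ (not_le.1 hx).le, mul_zero, mul_zero]
  have hcont : Continuous fun x : EuclideanSpace ℝ (Fin n) => u x * h (‖x‖ ^ 2) :=
    (hu.contDiffOn.continuousOn.mul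
      (h.continuous.comp (by fun_prop)).continuousOn).continuous_of_tsupport_subset
      (isOpen_setOf_lt_norm r₀)
      ((tsupport_mul_subset_right.trans hsupp).trans (setOf_le_norm_sq_subset hb))
  have hcompact : HasCompactSupport fun x : EuclideanSpace ℝ (Fin n) => u x * h (‖x‖ ^ 2) :=
    (hasCompactSupport_comp_norm_sq h.hasCompactSupport).mul_left
  have hzero := (annihilatesLaplacians_indicator hu hV hb).mul_comp_norm_sq_eq_zero
    (hasFiniteMoments_indicator hu.contDiffOn.continuousOn hV hb) ((sq_nonneg r₀).trans hb.le)
    (h.hasCompactSupport.hasTemperateGrowth h.contDiff) hhb (hindicator ▸ hcont)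
    (hindicator ▸ hcompact)
  rw [hindicator] at hzero
  simpa [h.one_of_mem_closedBall (mem_closedBall_self h.rIn_pos.le)] using congrFun hzero x₀

lemma closure_setOf_lt_norm {E : Type*} [SeminormedAddCommGroup E] [NormedSpace ℝ E] {r : ℝ}
    (hr : r ≠ 0) : closure {x : E | r < ‖x‖} = {x | r ≤ ‖x‖} := by
  have hcompl : {x : E | r < ‖x‖} = (closedBall 0 r)ᶜ := by
    ext x
    simp
  rw [hcompl, closure_compl, interior_closedBall 0 hr]
  ext x
  simp

lemma exists_limsup_eq_top_of_not_vanishes (hV : ¬ VanishesToInfiniteOrderAtInfinity u) :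
    ∃ N : ℝ, 0 ≤ N ∧
      limsup (fun r : ℝ => ENNReal.ofReal (r ^ N) * tailL2 u r) atTop = ∞ := by
  simp only [VanishesToInfiniteOrderAtInfinity, not_forall] at hV
  obtain ⟨m, hm, hnot⟩ := hV
  refine ⟨m + 1, by linarith, ?_⟩
  obtain ⟨c, hc0, hc⟩ : ∃ c : ℝ≥0∞, c ≠ 0 ∧
      ∃ᶠ r : ℝ in atTop, c < ENNReal.ofReal (r ^ m) * tailL2 u r := by
    by_contra! hcon
    exact hnot (ENNReal.tendsto_nhds_zero.2 fun ε hε => hcon ε hε.ne')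
  have hlin : Tendsto (fun r : ℝ => ENNReal.ofReal r * c) atTop (𝓝 ∞) := by
    have := ENNReal.Tendsto.mul_const (b := c) ENNReal.tendsto_ofReal_atTop
      (Or.inl ENNReal.top_ne_zero)
    rwa [ENNReal.top_mul hc0] at this
  refine top_le_iff.1 (le_of_forall_lt fun M hM => ?_)
  obtain ⟨M', hMM', hM'⟩ := exists_between hM
  refine hMM'.trans_le (le_limsup_of_frequently_le ?_ (by isBoundedDefault))
  refine (hc.and_eventually ((hlin.eventually (lt_mem_nhds hM')).and
    (eventually_gt_atTop 0))).mono ?_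
  rintro r ⟨hcr, hMr, hr⟩
  rw [Real.rpow_add_one hr.ne', mul_comm (r ^ m), ENNReal.ofReal_mul hr.le, mul_assoc]
  exact hMr.le.trans (mul_le_mul_right hcr.le _)

end UniqueContinuation

theorem corollary3p7 (n : ℕ) (hn : 1 ≤ n) (r₀ : ℝ) (hr₀ : 0 < r₀)
    (u : EuclideanSpace ℝ (Fin n) → ℝ)
    (hcont : ContinuousOn u {x | r₀ ≤ ‖x‖})
    (hharm : HarmonicOnNhd u {x | r₀ < ‖x‖}) :
    (VanishesToInfiniteOrderAtInfinity u → ∀ x, r₀ ≤ ‖x‖ → u x = 0) ∧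
    ((∃ x, r₀ ≤ ‖x‖ ∧ u x ≠ 0) →
      ∃ N : ℝ, 0 ≤ N ∧
        limsup (fun r : ℝ => ENNReal.ofReal (r ^ N) * tailL2 u r) atTop = ∞) := by
  have hzero (hV : VanishesToInfiniteOrderAtInfinity u) : Set.EqOn u 0 {x | r₀ ≤ ‖x‖} :=
    .of_subset_closure (fun _ => hV.eq_zero_of_lt_norm hr₀.le hharm) hcont continuousOn_const
      (fun x (hx : r₀ < ‖x‖) => hx.le) (closure_setOf_lt_norm hr₀.ne').ge
  refine ⟨hzero, fun ⟨x, hx, hux⟩ => ?_⟩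
  exact exists_limsup_eq_top_of_not_vanishes fun hV => hux (hzero hV hx)
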